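/- A frame is a pair $(W,R)$ with $W\neq\emptyset$ and $R\subseteq W\times W$; it is Euclidean if $sRt$ and $sRu$ imply $tRu$ and $uRt$. A Euclidean modal logic is a consistent normal modal logic (in the language with propositional variables, $\bot$, $\neg$, $\vee$, $\Box$) containing all formulas $\Diamond\varphi\rightarrow\Box\Diamond\varphi$; $\mathbf{K5}$ is the least normal modal logic containing these formulas, and $\mathbf{K5}\oplus\varphi$ is the least normal modal logic extending $\mathbf{K5}$ and containing $\varphi$. $\mathrm{Fr}(\mathbf{L})$ is the class of all frames validating $\mathbf{L}$, and, for a class $\mathcal{C}$ of frames, $\mathrm{Th}(\mathcal{C})$ is the set of all first-order sentences (with one binary relation symbol and equality) valid in every frame of $\mathcal{C}$. Let $\mathbf{N}^{+}=\mathbb{N}\setminus\{0\}$ and $\mathbf{N}^{-}=\mathbb{N}\cup\{-1\}$. For $m\in\mathbf{N}^{+}$ and $n\in\mathbf{N}^{-}$, the flower $\mathcal{F}_m^n$ is the following frame: if $n\geq 0$, its worlds are $0,1,\ldots,m+n$ and its relation is $(\{0\}\times\{1,\ldots,m\})\cup\{1,\ldots,m+n\}^2$; if $n=-1$, its worlds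 are $1,\ldots,m$ and its relation is $\{1,\ldots,m\}^2$. Let $S_{\mathbf{L}}=\{(m,n)\in\mathbf{N}^{+}\times\mathbf{N}^{-}:\mathcal{F}_m^n\models\mathbf{L}\}$. For a first-order formula $A$, let $\mathrm{qdd}(A)=\max\{\mathrm{qd}(A),3\}$, where $\mathrm{qd}(A)$ is the quantifier depth of $A$. **Lemma.** Let $\mathbf{L}$ be a Euclidean modal logic such that the set $$S_{\mathbf{L}}\setminus\big((\{1\}\times\mathbf{N}^{-})\cup(\mathbf{N}^{+}\times\{-1,0,1\})\big)$$ is finite. Let $\varphi$ be a modal formula such that $\mathbf{L}=\mathbf{K5}\oplus\varphi$. Let $k$ be the least integer such that $k\geq 4$ and $m+n\leq k$ for all $(m,n)$ in this set. Then for every first-order sentence $A$ the following conditions are equivalent: 1. $A\in\mathrm{Th}(\mathrm{Fr}(\mathbf{L}))$; 2. for every finite Euclidean frame $(W,R)$, if $$|W|\leq 2\cdot q\cdot(QK+1)^2\cdot 2^{(QK)^2}\cdot Q\cdot K$$ and $\varphi$ is valid in $(W,R)$, then $A$ is valid in $(W,R)$, where $q=\mathrm{qdd}(A)$, $Q=2q\,(q(q+1)^2+1)$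 and $K=2^k$. -/

import Mathlib

universe u

/-- A frame: a non-empty set of worlds with a binary relation on it. -/
structure KripkeFrame where
  W : Type u
  R : W → W → Prop
  nonempty : Nonempty W

/-- `(W, R)` is Euclidean: if `s R t` and `s R u` then `t R u` and `u R t`. -/
def KripkeFrame.IsEuclidean (F : KripkeFrame.{u}) : Prop :=
  ∀ s t v : F.W, F.R s t → F.R s v → F.R t v ∧ F.R v t

/-- Modal formulas over the countably infinite set `ℕ` of propositional variables. -/
inductive ModalFormula : Type where
  | var : ℕ → ModalFormula
  | bot : ModalFormula
  | neg : ModalFormula → ModalFormula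
  | or : ModalFormula → ModalFormula → ModalFormula
  | box : ModalFormula → ModalFormula

namespace ModalFormula

def imp (φ ψ : ModalFormula) : ModalFormula := or (neg φ) ψ

def dia (φ : ModalFormula) : ModalFormula := neg (box (neg φ))

/-- Uniform substitution of formulas for propositional variables. -/
def subst (σ : ℕ → ModalFormula) : ModalFormula → ModalFormula
  | var p => σ p
  | bot => bot
  | neg φ => neg (subst σ φ)
  | or φ ψ => or (subst σ φ) (subst σ ψ)
  | box φ => box (subst σ φ)

/-- Satisfiability of a modal formula at a world with respect to a valuation. -/
def Sat (F : KripkeFrame.{u}) (V : ℕ → Set F.W) : F.W → ModalFormula → Prop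
  | s, var p => s ∈ V p
  | _, bot => False
  | s, neg φ => ¬ Sat F V s φ
  | s, or φ ψ => Sat F V s φ ∨ Sat F V s ψ
  | s, box φ => ∀ t : F.W, F.R s t → Sat F V t φ

/-- Propositional tautologies: the formulas that every truth assignment compatible with
the Boolean connectives makes true, the variables and the boxed formulas being treated
as atoms. -/
def IsTautology (φ : ModalFormula) : Prop :=
  ∀ v : ModalFormula → Prop, ¬ v bot → (∀ α, v (neg α) ↔ ¬ v α) →
    (∀ α β, v (or α β) ↔ (v α ∨ v β)) → v φ

end ModalFormula

/-- Validity of a modal formula in a frame. -/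
def KripkeFrame.ModalValid (F : KripkeFrame.{u}) (φ : ModalFormula) : Prop :=
  ∀ (V : ℕ → Set F.W) (s : F.W), ModalFormula.Sat F V s φ

/-- Normal modal logics. -/
structure IsNormalModalLogic (L : Set ModalFormula) : Prop where
  subst_mem : ∀ (σ : ℕ → ModalFormula) (φ : ModalFormula), φ ∈ L → φ.subst σ ∈ L
  tautology_mem : ∀ φ : ModalFormula, φ.IsTautology → φ ∈ L
  distribution_mem : ∀ φ ψ : ModalFormula,
    ((φ.imp ψ).box).imp (φ.box.imp ψ.box) ∈ L
  modus_ponens : ∀ φ ψ : ModalFormula, φ ∈ L → φ.imp ψ ∈ L → ψ ∈ L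
  necessitation : ∀ φ : ModalFormula, φ ∈ L → φ.box ∈ L

/-- Euclidean modal logics: the consistent normal modal logics containing all formulas
`◇φ → □◇φ`. -/
structure IsEuclideanModalLogic (L : Set ModalFormula) : Prop where
  normal : IsNormalModalLogic L
  consistent : ModalFormula.bot ∉ L
  five_mem : ∀ φ : ModalFormula, φ.dia.imp φ.dia.box ∈ L

/-- The logic `K5`: the least normal modal logic containing all formulas `◇φ → □◇φ`. -/
def logicK5 : Set ModalFormula :=
  {ψ | ∀ L : Set ModalFormula, IsNormalModalLogic L →
    (∀ φ : ModalFormula, φ.dia.imp φ.dia.box ∈ L) → ψ ∈ L}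

/-- `K5 ⊕ φ`: the least normal modal logic extending `K5` and containing `φ`. -/
def logicK5Plus (φ : ModalFormula) : Set ModalFormula :=
  {ψ | ∀ L : Set ModalFormula, IsNormalModalLogic L → logicK5 ⊆ L → φ ∈ L → ψ ∈ L}

/-- `Fr(L)`: the class of all frames validating `L`. -/
def frameClass (L : Set ModalFormula) : Set KripkeFrame.{u} :=
  {F | ∀ φ ∈ L, F.ModalValid φ}

/-- The set `ℕ ∪ {-1}`. -/
def NMinus : Type := {n : ℤ // -1 ≤ n}

/-- The worlds of the flower `F_m^n`: the integers `0, …, m + n` if `n ≥ 0`, and the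
integers `1, …, m` if `n = -1`. -/
def flowerWorlds (m : ℕ+) (n : NMinus) : Set ℤ :=
  if n.1 = -1 then Set.Icc 1 (m : ℤ) else Set.Icc 0 ((m : ℤ) + n.1)

theorem one_mem_flowerWorlds (m : ℕ+) (n : NMinus) : (1 : ℤ) ∈ flowerWorlds m n := by
  have hm : (1 : ℤ) ≤ (m : ℤ) := by exact_mod_cast m.pos
  have hn := n.2
  unfold flowerWorlds
  split_ifs with h
  · exact ⟨le_refl _, hm⟩
  · refine ⟨by omega, ?_⟩
    have : 0 ≤ n.1 := by omega
    omega

/-- The flower `F_m^n`. The world `0` (present only if `n ≥ 0`) sees exactly `1, …, m`,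
and the worlds other than `0` see exactly the worlds other than `0`. -/
def flower (m : ℕ+) (n : NMinus) : KripkeFrame.{0} where
  W := {i : ℤ // i ∈ flowerWorlds m n}
  R := fun i j => (i.1 = 0 ∧ 1 ≤ j.1 ∧ j.1 ≤ (m : ℤ)) ∨ (1 ≤ i.1 ∧ 1 ≤ j.1)
  nonempty := ⟨⟨1, one_mem_flowerWorlds m n⟩⟩

/-- `S_L`: the set of all `(m, n)` such that the flower `F_m^n` validates `L`. -/
def flowerSet (L : Set ModalFormula) : Set (ℕ+ × NMinus) :=
  {p | ∀ φ ∈ L, (flower p.1 p.2).ModalValid φ}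

/-- `({1} × N⁻) ∪ (N⁺ × {-1, 0, 1})`. -/
def simplePairs : Set (ℕ+ × NMinus) :=
  {p | p.1 = 1} ∪ {p | p.2.1 = -1 ∨ p.2.1 = 0 ∨ p.2.1 = 1}

/-- First-order formulas in one binary relation symbol and equality, over the countably
infinite set `ℕ` of individual variables. -/
inductive FrameFormula : Type where
  | rel : ℕ → ℕ → FrameFormula
  | eq : ℕ → ℕ → FrameFormula
  | neg : FrameFormula → FrameFormula
  | or : FrameFormula → FrameFormula → FrameFormula
  | all : ℕ → FrameFormula → FrameFormula

namespace FrameFormula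

/-- Free individual variables. -/
def fiv : FrameFormula → Finset ℕ
  | rel x y => {x, y}
  | eq x y => {x, y}
  | neg A => fiv A
  | or A B => fiv A ∪ fiv B
  | all x A => (fiv A).erase x

def IsSentence (A : FrameFormula) : Prop := A.fiv = ∅

/-- Quantifier depth. -/
def qd : FrameFormula → ℕ
  | rel _ _ => 0
  | eq _ _ => 0
  | neg A => qd A
  | or A B => max (qd A) (qd B)
  | all _ A => qd A + 1

def qdd (A : FrameFormula) : ℕ := max A.qd 3

/-- Satisfiability of a first-order formula with respect to an assignment. -/
def Sat (F : KripkeFrame.{u}) : (ℕ → F.W) → FrameFormula → Prop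
  | g, rel x y => F.R (g x) (g y)
  | g, eq x y => g x = g y
  | g, neg A => ¬ Sat F g A
  | g, or A B => Sat F g A ∨ Sat F g B
  | g, all x A => ∀ s : F.W, Sat F (Function.update g x s) A

end FrameFormula

/-- Validity of a first-order formula in a frame. -/
def KripkeFrame.FOValid (F : KripkeFrame.{u}) (A : FrameFormula) : Prop :=
  ∀ g : ℕ → F.W, FrameFormula.Sat F g A

/-- `Th(C)`: the set of all sentences valid in every frame of the class `C`. -/
def theoryOf (C : Set KripkeFrame.{u}) : Set FrameFormula :=
  {A | A.IsSentence ∧ ∀ F ∈ C, F.FOValid A}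

/-- With `Q = 2q(q(q+1)² + 1)` and `K = 2^k`, the number
`2 · q · (QK + 1)² · 2^((QK)²) · Q · K`. -/
def frameSizeBound (q k : ℕ) : ℕ :=
  let Q := 2 * q * (q * (q + 1) ^ 2 + 1)
  let K := 2 ^ k
  2 * q * (Q * K + 1) ^ 2 * 2 ^ ((Q * K) ^ 2) * Q * K

-- Condition 1 implies 2 because the frames of `logicK5Plus φ` are the Euclidean frames validating
-- `φ`. For the converse, a Euclidean countermodel to `A` is shrunk to a finite one.
--
-- In a Euclidean frame every seen world is reflexive and the worlds seen from a reflexive world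
-- form a complete cluster. So a component is a cluster with irreflexive roots, each seeing a
-- non-empty part of it, or a world that sees nothing and is seen by nothing.
--
-- All shrinking goes through `Absorbs`: if any world can be moved into `S` by an automorphism
-- fixing fewer than `q` given worlds of `S`, then the subframe on `S` agrees with the frame on
-- sentences of quantifier depth at most `q` (`Absorbs.sat_iff`) and still validates `φ`
-- (`Absorbs.modalValid`). It is applied three times: to keep `q` roots for each set of successors,
-- to keep boundedly many worlds of each cluster, and to keep `q` components of each type.
--
-- The modal logic enters in the second round. A root that sees at least two worlds and misses at
-- least two worlds of a cluster with more than `k` worlds would give a flower with `m + n = k + 1`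
-- validating the logic (`IsEuclidean.hasSimpleLargeFlowers`). Hence a root below a large cluster
-- sees one world, all but one, or all, and two worlds of the cluster can be exchanged once they
-- carry equally many roots of the first two kinds.

universe v

/-! ### Modal truth under bounded morphisms and substitution. -/

namespace ModalFormula

/-- Truth is preserved by a map that is a bounded morphism on a set of worlds closed under
the accessibility relation. -/
theorem sat_iff_of_boundedMorphismOn {F : KripkeFrame.{u}} {G : KripkeFrame.{v}}
    (f : F.W → G.W) (D : Set F.W)
    (hD : ∀ x ∈ D, ∀ y, F.R x y → y ∈ D)
    (hforth : ∀ x ∈ D, ∀ y, F.R x y → G.R (f x) (f y))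
    (hback : ∀ x ∈ D, ∀ z, G.R (f x) z → ∃ y, F.R x y ∧ f y = z)
    (V : ℕ → Set G.W) (φ : ModalFormula) :
    ∀ x ∈ D, (Sat F (fun p => f ⁻¹' V p) x φ ↔ Sat G V (f x) φ) := by
  induction φ with
  | var p => intro x _; rfl
  | bot => intro x _; rfl
  | neg φ ih => intro x hx; exact not_congr (ih x hx)
  | or φ ψ ih₁ ih₂ => intro x hx; exact or_congr (ih₁ x hx) (ih₂ x hx)
  | box φ ih =>
    intro x hx
    constructor
    · intro h z hz
      obtain ⟨y, hy, rfl⟩ := hback x hx z hz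
      exact (ih y (hD x hx y hy)).1 (h y hy)
    · intro h y hy
      exact (ih y (hD x hx y hy)).2 (h _ (hforth x hx y hy))

theorem sat_subst (F : KripkeFrame.{u}) (V : ℕ → Set F.W) (σ : ℕ → ModalFormula)
    (φ : ModalFormula) :
    ∀ s, Sat F V s (φ.subst σ) ↔ Sat F (fun p => {t | Sat F V t (σ p)}) s φ := by
  induction φ with
  | var p => intro s; rfl
  | bot => intro s; rfl
  | neg φ ih => intro s; exact not_congr (ih s)
  | or φ ψ ih₁ ih₂ => intro s; exact or_congr (ih₁ s) (ih₂ s)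
  | box φ ih => intro s; exact forall₂_congr fun t _ => ih t

theorem sat_imp {F : KripkeFrame.{u}} {V : ℕ → Set F.W} {s : F.W} {φ ψ : ModalFormula} :
    Sat F V s (φ.imp ψ) ↔ (Sat F V s φ → Sat F V s ψ) :=
  imp_iff_not_or.symm

theorem sat_dia {F : KripkeFrame.{u}} {V : ℕ → Set F.W} {s : F.W} {φ : ModalFormula} :
    Sat F V s φ.dia ↔ ∃ t, F.R s t ∧ Sat F V t φ := by
  simp [dia, Sat]

end ModalFormula

/-! ### Frames of K5 and its extensions. -/

namespace KripkeFrame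

open ModalFormula

theorem isNormalModalLogic_setOf_modalValid (F : KripkeFrame.{u}) :
    IsNormalModalLogic {φ | F.ModalValid φ} where
  subst_mem σ φ h V s := (sat_subst F V σ φ s).2 (h _ s)
  tautology_mem φ h V s :=
    h (Sat F V s) id (fun _ => Iff.rfl) fun _ _ => Iff.rfl
  distribution_mem φ ψ V s := by
    rw [sat_imp, sat_imp]
    exact fun h₁ h₂ t ht => sat_imp.1 (h₁ t ht) (h₂ t ht)
  modus_ponens φ ψ h₁ h₂ V s := sat_imp.1 (h₂ V s) (h₁ V s)
  necessitation φ h V s t _ := h V t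

theorem IsEuclidean.modalValid_five {F : KripkeFrame.{u}} (hF : F.IsEuclidean)
    (φ : ModalFormula) : F.ModalValid (φ.dia.imp φ.dia.box) := by
  intro V s
  rw [sat_imp, sat_dia]
  rintro ⟨t, hst, ht⟩ v hsv
  exact sat_dia.2 ⟨t, (hF s t v hst hsv).2, ht⟩

theorem isEuclidean_of_modalValid_five {F : KripkeFrame.{u}}
    (h : F.ModalValid ((var 0).dia.imp (var 0).dia.box)) : F.IsEuclidean := by
  have key : ∀ s t v, F.R s t → F.R s v → F.R v t := by
    intro s t v hst hsv
    -- The variable holds at `t` alone, so the diamond at `v` can only be witnessed by `t`.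
    obtain ⟨w, hvw, hw⟩ := sat_dia.1
      (sat_imp.1 (h (fun _ => {t}) s) (sat_dia.2 ⟨t, hst, rfl⟩) v hsv)
    have hwt : w = t := hw
    exact hwt ▸ hvw
  exact fun s t v hst hsv => ⟨key s v t hsv hst, key s t v hst hsv⟩

/-- Only soundness is needed: the formulas valid in one frame form a normal logic, so they include
the least one. -/
theorem mem_frameClass_logicK5Plus (F : KripkeFrame.{u}) (φ : ModalFormula) :
    F ∈ frameClass.{u} (logicK5Plus φ) ↔ F.IsEuclidean ∧ F.ModalValid φ := by
  constructor
  · intro h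
    refine ⟨isEuclidean_of_modalValid_five (h _ fun L hL hK _ => hK fun L' _ h5 => h5 _),
      h _ fun L _ _ hφ => hφ⟩
  · rintro ⟨hF, hφ⟩ ψ hψ
    exact hψ _ F.isNormalModalLogic_setOf_modalValid
      (fun χ hχ => hχ _ F.isNormalModalLogic_setOf_modalValid hF.modalValid_five) hφ

end KripkeFrame

/-! ### First-order satisfaction, automorphisms and absorbing sets. -/

namespace FrameFormula

theorem sat_congr (F : KripkeFrame.{u}) (A : FrameFormula) :
    ∀ g h : ℕ → F.W, (∀ x ∈ A.fiv, g x = h x) → (Sat F g A ↔ Sat F h A) := by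
  induction A with
  | rel x y => intro g h hgh; simp only [Sat]; rw [hgh x (by simp [fiv]), hgh y (by simp [fiv])]
  | eq x y => intro g h hgh; simp only [Sat]; rw [hgh x (by simp [fiv]), hgh y (by simp [fiv])]
  | neg A ih => intro g h hgh; exact not_congr (ih g h hgh)
  | or A B ih₁ ih₂ =>
    intro g h hgh
    exact or_congr (ih₁ g h fun x hx => hgh x (by simp [fiv, hx]))
      (ih₂ g h fun x hx => hgh x (by simp [fiv, hx]))
  | all x A ih =>
    intro g h hgh
    refine forall_congr' fun s => ih _ _ fun y hy => ?_
    by_cases hyx : y = x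
    · simp [hyx]
    · simp [hyx, hgh y (by simp [fiv, hy, hyx])]

end FrameFormula

namespace KripkeFrame

/-- `σ` is an automorphism of the frame. -/
def IsAut (F : KripkeFrame.{u}) (σ : Equiv.Perm F.W) : Prop :=
  ∀ x y, F.R (σ x) (σ y) ↔ F.R x y

theorem IsAut.sat_iff {F : KripkeFrame.{u}} {σ : Equiv.Perm F.W} (hσ : F.IsAut σ)
    (A : FrameFormula) : ∀ g : ℕ → F.W, FrameFormula.Sat F (σ ∘ g) A ↔ FrameFormula.Sat F g A := by
  induction A with
  | rel x y => intro g; exact hσ _ _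
  | eq x y => intro g; exact σ.injective.eq_iff
  | neg A ih => intro g; exact not_congr (ih g)
  | or A B ih₁ ih₂ => intro g; exact or_congr (ih₁ g) (ih₂ g)
  | all x A ih =>
    intro g
    refine σ.symm.forall_congr fun {s} => ?_
    rw [← ih (Function.update g x _), Function.comp_update, σ.apply_symm_apply]

/-- The subframe induced on a non-empty set of worlds. -/
def induce (F : KripkeFrame.{u}) (S : Set F.W) (hS : S.Nonempty) : KripkeFrame.{u} where
  W := S
  R x y := F.R x.1 y.1
  nonempty := hS.to_subtype

theorem IsEuclidean.induce {F : KripkeFrame.{u}} (hF : F.IsEuclidean) (S : Set F.W)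
    (hS : S.Nonempty) : (F.induce S hS).IsEuclidean :=
  fun s t v => hF s.1 t.1 v.1

/-- Every world can be moved into `S` by an automorphism fixing fewer than `q` given worlds
of `S`. -/
def Absorbs (F : KripkeFrame.{u}) (q : ℕ) (S : Set F.W) : Prop :=
  ∀ (t : Finset F.W) (w : F.W), ↑t ⊆ S → t.card < q →
    ∃ σ : Equiv.Perm F.W, F.IsAut σ ∧ (∀ x ∈ t, σ x = x) ∧ σ w ∈ S

namespace Absorbs

variable {F : KripkeFrame.{u}} {q : ℕ} {S : Set F.W}

theorem nonempty (h : F.Absorbs q S) (hq : 0 < q) : S.Nonempty := by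
  obtain ⟨w⟩ := F.nonempty
  obtain ⟨σ, -, -, hσ⟩ := h ∅ w (by simp) (by simpa)
  exact ⟨_, hσ⟩

-- The quantity kept below `q` is the depth still to come plus the number of distinct parameters in
-- use. At a quantifier fewer than `q` parameters occur, so an automorphism fixing them brings any
-- witness into `S`.
open Classical in
theorem sat_iff (h : F.Absorbs q S) (hS : S.Nonempty) (A : FrameFormula) :
    ∀ g : ℕ → (F.induce S hS).W, A.qd + (A.fiv.image g).card ≤ q →
      (FrameFormula.Sat (F.induce S hS) g A ↔ FrameFormula.Sat F (fun x => (g x).1) A) := by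
  induction A with
  | rel x y => intro g _; rfl
  | eq x y => intro g _; exact Subtype.ext_iff
  | neg A ih => intro g hg; exact not_congr (ih g hg)
  | or A B ih₁ ih₂ =>
    intro g hg
    simp only [FrameFormula.qd, FrameFormula.fiv] at hg
    refine or_congr (ih₁ g ?_) (ih₂ g ?_)
    · have := Finset.card_le_card (Finset.image_subset_image (f := g)
        (Finset.subset_union_left (s₁ := A.fiv) (s₂ := B.fiv)))
      omega
    · have := Finset.card_le_card (Finset.image_subset_image (f := g)
        (Finset.subset_union_right (s₁ := A.fiv) (s₂ := B.fiv)))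
      omega
  | all x A ih =>
    intro g hg
    simp only [FrameFormula.qd, FrameFormula.fiv] at hg
    have hup : ∀ s : (F.induce S hS).W, FrameFormula.Sat (F.induce S hS) (Function.update g x s) A ↔
        FrameFormula.Sat F (Function.update (fun x => (g x).1) x s.1) A := by
      intro s
      rw [ih (Function.update g x s)]
      · apply FrameFormula.sat_congr
        intro y _
        by_cases hy : y = x
        · subst hy; simp
        · simp [hy]
      · have : A.fiv.image (Function.update g x s) ⊆ insert s ((A.fiv.erase x).image g) := by
          intro y hy
          obtain ⟨z, hz, rfl⟩ := Finset.mem_image.1 hy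
          by_cases hzx : z = x
          · subst hzx; simp
          · rw [Function.update_of_ne hzx]
            exact Finset.mem_insert_of_mem
              (Finset.mem_image_of_mem _ (Finset.mem_erase.2 ⟨hzx, hz⟩))
        have := (Finset.card_le_card this).trans (Finset.card_insert_le _ _)
        omega
    constructor
    · intro hall w
      obtain ⟨σ, hσ, hfix, hw⟩ := h ((A.fiv.erase x).image fun y => (g y).1) w
        (by
          intro y hy
          obtain ⟨z, -, rfl⟩ := Finset.mem_image.1 (Finset.mem_coe.1 hy)
          exact (g z).2)
        (by
          have hle : ((A.fiv.erase x).image fun y => (g y).1).card ≤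
              ((A.fiv.erase x).image g).card := by
            have : ((A.fiv.erase x).image fun y => (g y).1) =
                ((A.fiv.erase x).image g).image (fun s => s.1) :=
              Finset.image_image.symm
            rw [this]
            exact Finset.card_image_le
          omega)
      rw [← hσ.sat_iff, Function.comp_update]
      refine (FrameFormula.sat_congr F A _ _ ?_).1 ((hup ⟨σ w, hw⟩).1 (hall ⟨σ w, hw⟩))
      intro y hy
      by_cases hyx : y = x
      · subst hyx; simp
      · simp only [Function.update_of_ne hyx, Function.comp_apply]
        exact (hfix _ (Finset.mem_image_of_mem _ (Finset.mem_erase.2 ⟨hyx, hy⟩))).symm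
    · intro hall s
      exact (hup s).2 (hall s.1)

theorem foValid (h : F.Absorbs q S) (hS : S.Nonempty) {A : FrameFormula} (hA : A.IsSentence)
    (hq : A.qd ≤ q) (hv : (F.induce S hS).FOValid A) : F.FOValid A := by
  intro g
  have hA' : A.fiv = ∅ := hA
  let g' : ℕ → (F.induce S hS).W := fun _ => ⟨hS.some, hS.some_mem⟩
  have := (h.sat_iff hS A g' (by simpa [hA'])).1 (hv g')
  exact (FrameFormula.sat_congr F A _ _ (by simp [hA'])).1 this

theorem exists_rel (h : F.Absorbs q S) (hq : 1 < q) {s w : F.W} (hs : s ∈ S) (hw : F.R s w) :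
    ∃ d ∈ S, F.R s d := by
  obtain ⟨σ, hσ, hfix, hmem⟩ := h {s} w (by simpa) (by simpa)
  refine ⟨σ w, hmem, ?_⟩
  have := (hσ s w).2 hw
  rwa [hfix s (by simp)] at this

/-- A world distinguishing `s` from `t` can be moved into `S` with both fixed. Fixing two worlds
requires `q` to be at least 3, hence the 3 in `qdd`. -/
theorem rel_congr (h : F.Absorbs q S) (hq : 2 < q) {s t : F.W} (hs : s ∈ S) (ht : t ∈ S)
    (hst : ∀ w ∈ S, F.R s w ↔ F.R t w) (w : F.W) : F.R s w ↔ F.R t w := by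
  classical
  obtain ⟨σ, hσ, hfix, hmem⟩ := h {s, t} w (by simp [Set.insert_subset_iff, hs, ht])
    (Finset.card_le_two.trans_lt hq)
  have hs' := hσ s w
  have ht' := hσ t w
  rw [hfix s (by simp)] at hs'
  rw [hfix t (by simp)] at ht'
  rw [← hs', ← ht', hst _ hmem]

theorem modalValid (h : F.Absorbs q S) (hq : 1 < q) (hF : F.IsEuclidean) (hS : S.Nonempty)
    {φ : ModalFormula} (hφ : F.ModalValid φ) : (F.induce S hS).ModalValid φ := by
  classical
  rintro V ⟨s, hs⟩
  obtain ⟨d, hd⟩ : ∃ d : S, ∀ w, F.R s w → F.R s d := by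
    by_cases hw : ∃ w, F.R s w
    · obtain ⟨w, hw⟩ := hw
      obtain ⟨d, hd, hsd⟩ := h.exists_rel hq hs hw
      exact ⟨⟨d, hd⟩, fun _ _ => hsd⟩
    · exact ⟨⟨s, hs⟩, fun w hsw => absurd ⟨w, hsw⟩ hw⟩
  -- All worlds outside `S` collapse to `d`. If `s` sees something, `d` is a successor of `s`, and
  -- the worlds reachable from `s` lie in the complete cluster of `d`, where such a collapse is a
  -- bounded morphism.
  let f : F.W → (F.induce S hS).W := fun x => if hx : x ∈ S then ⟨x, hx⟩ else d
  have hfS : ∀ x (hx : x ∈ S), f x = ⟨x, hx⟩ := fun x hx => dif_pos hx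
  have hfval : ∀ x, (f x).1 = x ∨ (f x).1 = d.1 := by
    intro x
    by_cases hx : x ∈ S
    · left; rw [hfS x hx]
    · right; simp [f, hx]
  by_cases hw : ∃ w, F.R s w
  · obtain ⟨w, hw⟩ := hw
    have hsd : F.R s d := hd w hw
    have hdd : F.R d d := (hF s d d hsd hsd).1
    have := (ModalFormula.sat_iff_of_boundedMorphismOn (G := F.induce S hS) f
      {x | x = s ∨ F.R d x} ?_ ?_ ?_ V φ s (Or.inl rfl)).1 (hφ _ s)
    · rwa [hfS s hs] at this
    · rintro x (rfl | hx) y hxy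
      · exact Or.inr (hF _ _ _ hsd hxy).1
      · exact Or.inr (hF _ _ _ (hF _ _ _ hx hdd).1 hxy).1
    · rintro x (rfl | hx) y hxy
      · change F.R (f x).1 (f y).1
        rw [hfS x hs]
        rcases hfval y with h' | h' <;> rw [h'] <;> assumption
      · change F.R (f x).1 (f y).1
        have hdy : F.R d y := (hF _ _ _ (hF _ _ _ hx hdd).1 hxy).1
        have h₁ : F.R d (f x).1 := by rcases hfval x with h' | h' <;> rw [h'] <;> assumption
        have h₂ : F.R d (f y).1 := by rcases hfval y with h' | h' <;> rw [h'] <;> assumption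
        exact (hF _ _ _ h₁ h₂).1
    · rintro x (rfl | hx) ⟨z, hz⟩ hxz
      · refine ⟨z, ?_, hfS z hz⟩
        change F.R (f x).1 z at hxz
        rwa [hfS x hs] at hxz
      · refine ⟨z, ?_, hfS z hz⟩
        change F.R (f x).1 z at hxz
        have h₁ : F.R d (f x).1 := by rcases hfval x with h' | h' <;> rw [h'] <;> assumption
        have hdz : F.R d z := (hF _ _ _ (hF _ _ _ h₁ hdd).1 hxz).1
        exact (hF _ _ _ hx hdz).1
  · have hno : ∀ y, ¬ F.R s y := fun y hy => hw ⟨y, hy⟩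
    have := (ModalFormula.sat_iff_of_boundedMorphismOn (G := F.induce S hS) f
      {s} ?_ ?_ ?_ V φ s rfl).1 (hφ _ s)
    · rwa [hfS s hs] at this
    · rintro x rfl y hxy; exact absurd hxy (hno y)
    · rintro x rfl y hxy; exact absurd hxy (hno y)
    · rintro x rfl z hxz
      change F.R (f x).1 z.1 at hxz
      rw [hfS x hs] at hxz
      exact absurd hxz (hno _)

/-- Keeping enough interchangeable blocks of worlds. -/
theorem of_blocks {I : Type*} (b : F.W → I) (S : Set I)
    (h : ∀ i ∉ S, ∃ T : Finset I, ↑T ⊆ S ∧ q ≤ T.card ∧ ∀ j ∈ T, ∃ σ : Equiv.Perm F.W,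
      F.IsAut σ ∧ (∀ x, b x ≠ i → b x ≠ j → σ x = x) ∧ ∀ x, b x = i → b (σ x) = j) :
    F.Absorbs q (b ⁻¹' S) := by
  classical
  intro t w ht hcard
  by_cases hw : b w ∈ S
  · exact ⟨1, fun _ _ => Iff.rfl, fun _ _ => rfl, hw⟩
  · obtain ⟨T, hTS, hTq, hT⟩ := h _ hw
    -- Fewer than `q` parameters meet fewer than `q` blocks, so one of the `q` candidates contains
    -- none of them.
    obtain ⟨j, hjT, hj⟩ := Finset.exists_mem_notMem_of_card_lt_card
      (s := t.image b) (t := T) (by have := Finset.card_image_le (s := t) (f := b); omega)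
    obtain ⟨σ, hσ, hfix, hmove⟩ := hT j hjT
    refine ⟨σ, hσ, fun x hx => hfix x ?_ ?_, ?_⟩
    · intro hxi
      exact hw (hxi ▸ ht hx)
    · intro hxj
      exact hj (hxj ▸ Finset.mem_image_of_mem b hx)
    · change b (σ w) ∈ S
      rw [hmove w rfl]
      exact hTS hjT

end Absorbs

end KripkeFrame

/-! ### Selection by colours and permutations built fibrewise. -/

/-- A set containing at most `q` elements of each colour, and at least `q` of each colour
that it does not exhaust. -/
theorem exists_colour_selection {I : Type*} {C : Type*} (col : I → C) (q : ℕ) :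
    ∃ S : Set I, (∀ i ∉ S, ∃ T : Finset I, ↑T ⊆ S ∧ q ≤ T.card ∧ ∀ j ∈ T, col i = col j) ∧
      ∀ c, {i ∈ S | col i = c}.encard ≤ q := by
  have hex : ∀ c, ∃ S : Set I, S ⊆ col ⁻¹' {c} ∧ S.encard ≤ q ∧
      (S = col ⁻¹' {c} ∨ S.encard = q) := by
    intro c
    rcases le_total (col ⁻¹' {c}).encard q with h | h
    · exact ⟨_, subset_rfl, h, Or.inl rfl⟩
    · obtain ⟨S, hS, hq⟩ := Set.exists_subset_encard_eq h
      exact ⟨S, hS, hq.le, Or.inr hq⟩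
  choose S hsub hle hor using hex
  have hmem : ∀ i c, i ∈ S c → col i = c := fun i c hi => hsub c hi
  refine ⟨{i | i ∈ S (col i)}, ?_, ?_⟩
  · intro i hi
    rcases hor (col i) with h | h
    · exact absurd (show i ∈ S (col i) by rw [h]; rfl) hi
    · have hfin : (S (col i)).Finite := Set.finite_of_encard_eq_coe h
      refine ⟨hfin.toFinset, ?_, ?_, ?_⟩
      · intro j hj
        have hj' : j ∈ S (col i) := by simpa using hj
        have := hmem _ _ hj'
        simpa [this] using hj'
      · rw [hfin.encard_eq_coe_toFinset_card] at h
        exact_mod_cast h.ge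
      · intro j hj
        exact (hmem _ _ (by simpa using hj)).symm
  · intro c
    refine le_trans (Set.encard_le_encard ?_) (hle c)
    rintro i ⟨hi, rfl⟩
    exact hi

/-- A permutation assembled from bijections between the fibres of a map. -/
theorem bijective_of_bijOn_fibres {W T : Type*} (τ : W → T) (p : Equiv.Perm T)
    (f : T → W → W) (hf : ∀ t, Set.BijOn (f t) (τ ⁻¹' {t}) (τ ⁻¹' {p t})) :
    Function.Bijective fun x => f (τ x) x := by
  have hτ : ∀ x, τ (f (τ x) x) = p (τ x) := fun x => (hf (τ x)).mapsTo rfl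
  constructor
  · intro x y hxy
    have hxy' : f (τ x) x = f (τ y) y := hxy
    have h : τ x = τ y := p.injective (by rw [← hτ, ← hτ, hxy'])
    rw [h] at hxy'
    exact (hf (τ y)).injOn h rfl hxy'
  · intro y
    obtain ⟨x, hx, hxy⟩ := (hf (p.symm (τ y))).surjOn (show y ∈ _ by simp)
    have hx' : τ x = p.symm (τ y) := hx
    exact ⟨x, by simpa only [hx'] using hxy⟩

theorem exists_surjOn_Icc {W : Type*} {A : Set W} {m : ℕ} (hm : 1 ≤ m) (hA : m ≤ A.encard)
    (a : ℤ) : ∃ f : W → ℤ, (∀ x, f x ∈ Set.Icc (a + 1) (a + m)) ∧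
      Set.SurjOn f A (Set.Icc (a + 1) (a + m)) := by
  classical
  obtain ⟨A₀, hA₀, hcard⟩ := Set.exists_subset_encard_eq hA
  have hIcc : (Set.Icc (a + 1) (a + m)).encard = m := by
    rw [← Finset.coe_Icc, Set.encard_coe_eq_coe_finsetCard, Int.card_Icc]
    congr 1
    omega
  obtain ⟨f, hf⟩ := (Set.finite_of_encard_eq_coe hcard).exists_bijOn_of_encard_eq
    (hcard.trans hIcc.symm)
  refine ⟨fun x => if x ∈ A₀ then f x else a + 1, fun x => ?_, fun z hz => ?_⟩
  · by_cases hx : x ∈ A₀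
    · simpa only [hx, if_true] using hf.mapsTo hx
    · simp only [hx, if_false]
      exact ⟨le_rfl, by omega⟩
  · obtain ⟨x, hx, rfl⟩ := hf.surjOn hz
    exact ⟨x, hA₀ hx, by simp [hx]⟩

/-! ### Flowers as bounded morphic images. -/

namespace KripkeFrame

/-- A Euclidean frame validates whatever it validates also on the flowers obtained by
collapsing the worlds seen by `s` to `m` worlds and the others in their cluster to `n`. -/
theorem IsEuclidean.modalValid_flower {F : KripkeFrame.{u}} (hF : F.IsEuclidean) {s c : F.W}
    (hsc : F.R s c) {m n : ℕ} (hm : 1 ≤ m) (hn : 1 ≤ n)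
    (hA : m ≤ {x | F.R s x}.encard) (hB : n ≤ {x | F.R c x ∧ ¬ F.R s x}.encard)
    {φ : ModalFormula} (hφ : F.ModalValid φ) :
    (flower ⟨m, hm⟩ ⟨n, by omega⟩).ModalValid φ := by
  classical
  have hcc : F.R c c := (hF _ _ _ hsc hsc).1
  have hsub : ∀ x, F.R s x → F.R c x := fun x hx => (hF _ _ _ hsc hx).1
  have hclus : ∀ x y, F.R c x → F.R c y → F.R x y := fun x y hx hy => (hF _ _ _ hx hy).1
  have hclosed : ∀ x y, F.R c x → F.R x y → F.R c y := fun x y hx hy =>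
    (hF _ _ _ (hclus x c hx hcc) hy).1
  -- If `s` were in the cluster it would see all of it, but it misses some world.
  have hcs : ¬ F.R c s := by
    intro hcs
    obtain ⟨x, hx, hx'⟩ : {x | F.R c x ∧ ¬ F.R s x}.Nonempty := by
      rw [← Set.one_le_encard_iff_nonempty]
      exact le_trans (by exact_mod_cast hn) hB
    exact hx' (hclus s x hcs hx)
  obtain ⟨fA, hfA, hsA⟩ := exists_surjOn_Icc hm hA 0
  obtain ⟨fB, hfB, hsB⟩ := exists_surjOn_Icc hn hB m
  -- The root goes to `0`, the worlds it sees onto `1, …, m`, and the rest of the cluster onto `m +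
  -- 1, …, m + n`; values elsewhere are irrelevant.
  let g : F.W → ℤ := fun x => if x = s then 0 else if F.R s x then fA x else fB x
  have hgs : g s = 0 := if_pos rfl
  have hgA : ∀ x, F.R s x → g x = fA x := by
    intro x hx
    have : x ≠ s := by rintro rfl; exact hcs (hsub _ hx)
    simp [g, this, hx]
  have hgB : ∀ x, F.R c x → ¬ F.R s x → g x = fB x := by
    intro x hx hx'
    have : x ≠ s := by rintro rfl; exact hcs hx
    simp [g, this, hx']
  have hgpos : ∀ x, F.R c x → 1 ≤ g x := by
    intro x hx
    by_cases hx' : F.R s x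
    · rw [hgA x hx']; have := (hfA x).1; omega
    · rw [hgB x hx hx']; have := (hfB x).1; omega
  have hworlds : flowerWorlds ⟨m, hm⟩ ⟨n, by omega⟩ = Set.Icc (0 : ℤ) (m + n) := by
    unfold flowerWorlds
    rw [if_neg (by simp only; omega)]
    rfl
  have hg : ∀ x, g x ∈ flowerWorlds ⟨m, hm⟩ ⟨n, by omega⟩ := by
    intro x
    rw [hworlds, Set.mem_Icc]
    have h₁ := hfA x
    have h₂ := hfB x
    rw [Set.mem_Icc] at h₁ h₂
    simp only [g]
    split_ifs <;> omega
  let f : F.W → (flower ⟨m, hm⟩ ⟨n, by omega⟩).W := fun x => ⟨g x, hg x⟩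
  intro V z
  obtain ⟨x, hx, rfl⟩ : ∃ x, (x = s ∨ F.R c x) ∧ f x = z := by
    obtain ⟨z, hz⟩ := z
    have hz' := hz
    rw [hworlds, Set.mem_Icc] at hz'
    rcases eq_or_ne z 0 with rfl | hz0
    · exact ⟨s, Or.inl rfl, Subtype.ext hgs⟩
    by_cases hzm : z ≤ m
    · obtain ⟨y, hy, rfl⟩ := hsA (show z ∈ _ by rw [Set.mem_Icc]; omega)
      exact ⟨y, Or.inr (hsub y hy), Subtype.ext (hgA y hy)⟩
    · obtain ⟨y, hy, rfl⟩ := hsB (show z ∈ _ by rw [Set.mem_Icc]; omega)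
      exact ⟨y, Or.inr hy.1, Subtype.ext (hgB y hy.1 hy.2)⟩
  refine (ModalFormula.sat_iff_of_boundedMorphismOn (G := flower ⟨m, hm⟩ ⟨n, by omega⟩) f
    {x | x = s ∨ F.R c x} ?_ ?_ ?_ V φ x hx).1 (hφ _ x)
  · rintro x (rfl | hx) y hxy
    · exact Or.inr (hsub y hxy)
    · exact Or.inr (hclosed x y hx hxy)
  · rintro x (rfl | hx) y hxy
    · refine Or.inl ⟨hgs, hgpos y (hsub y hxy), ?_⟩
      change g y ≤ m
      rw [hgA y hxy]
      have := (hfA y).2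
      omega
    · exact Or.inr ⟨hgpos x hx, hgpos y (hclosed x y hx hxy)⟩
  · rintro x (rfl | hx) ⟨z, hz⟩ hxz
    · rcases hxz with ⟨-, h₁, h₂⟩ | ⟨h₁, -⟩
      · replace h₁ : 1 ≤ z := h₁
        replace h₂ : z ≤ m := h₂
        obtain ⟨y, hy, rfl⟩ := hsA (show z ∈ _ by rw [Set.mem_Icc]; omega)
        exact ⟨y, hy, Subtype.ext (hgA y hy)⟩
      · replace h₁ : 1 ≤ g x := h₁
        omega
    · have hz1 : 1 ≤ z := by
        rcases hxz with ⟨-, h₁, -⟩ | ⟨-, h₁⟩ <;> exact h₁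
      have hz' := hz
      rw [hworlds, Set.mem_Icc] at hz'
      by_cases hzm : z ≤ m
      · obtain ⟨y, hy, rfl⟩ := hsA (show z ∈ _ by rw [Set.mem_Icc]; omega)
        exact ⟨y, hclus x y hx (hsub y hy), Subtype.ext (hgA y hy)⟩
      · obtain ⟨y, hy, rfl⟩ := hsB (show z ∈ _ by rw [Set.mem_Icc]; omega)
        exact ⟨y, hclus x y hx hy.1, Subtype.ext (hgB y hy.1 hy.2)⟩

/-- A world sees at most one world, or misses at most one world, of the cluster above it,
unless the cluster has at most `k` worlds. -/
def HasSimpleLargeFlowers (F : KripkeFrame.{u}) (k : ℕ) : Prop :=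
  ∀ s c, F.R s c → 2 ≤ {x | F.R s x}.encard → 2 ≤ {x | F.R c x ∧ ¬ F.R s x}.encard →
    {x | F.R c x}.encard ≤ k

/-- Otherwise the seen and the missed worlds could be collapsed to `m ≥ 2` and `n ≥ 2` worlds with
`m + n = k + 1`, a flower exceeding the bound `k`. -/
theorem IsEuclidean.hasSimpleLargeFlowers {F : KripkeFrame.{u}} (hF : F.IsEuclidean)
    {L : Set ModalFormula} (hL : F ∈ frameClass.{u} L) {k : ℕ} (hk4 : 4 ≤ k)
    (hk : ∀ (m : ℕ+) (n : NMinus), (m, n) ∈ flowerSet L \ simplePairs →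
      (m : ℤ) + n.1 ≤ (k : ℤ)) : F.HasSimpleLargeFlowers k := by
  intro s c hsc hA hB
  by_contra! hlt
  have hsub : {x | F.R s x} ⊆ {x | F.R c x} := fun x hx => (hF _ _ _ hsc hx).1
  have hcard : {x | F.R c x ∧ ¬ F.R s x}.encard + {x | F.R s x}.encard =
      {x | F.R c x}.encard := Set.encard_sdiff_add_encard_of_subset hsub
  obtain ⟨m, n, hm, hn, hmn, hmA, hnB⟩ : ∃ m n : ℕ, 2 ≤ m ∧ 2 ≤ n ∧ m + n = k + 1 ∧
      m ≤ {x | F.R s x}.encard ∧ n ≤ {x | F.R c x ∧ ¬ F.R s x}.encard := by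
    rw [← hcard] at hlt
    generalize {x | F.R s x}.encard = a at *
    generalize {x | F.R c x ∧ ¬ F.R s x}.encard = b at *
    -- If many worlds are missed, two seen worlds suffice; otherwise all `b` missed worlds are kept
    -- and the seen ones fill up to `k + 1`.
    by_cases hb : ((k - 1 : ℕ) : ℕ∞) ≤ b
    · exact ⟨2, k - 1, le_rfl, by omega, by omega, hA, hb⟩
    · rw [not_le] at hb
      lift b to ℕ using hb.ne_top
      have hB' : 2 ≤ b := by exact_mod_cast hB
      have hb' : b < k - 1 := by exact_mod_cast hb
      refine ⟨k + 1 - b, b, by omega, hB', by omega, ?_, le_rfl⟩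
      induction a using ENat.recTopCoe with
      | top => exact le_top
      | coe a =>
        have : k < b + a := by exact_mod_cast hlt
        exact_mod_cast (by omega : k + 1 - b ≤ a)
  have := hk ⟨m, by omega⟩ ⟨n, by omega⟩ ⟨fun φ hφ =>
    hF.modalValid_flower hsc (by omega) (by omega) hmA hnB (hL φ hφ), ?_⟩
  · change (m : ℤ) + n ≤ k at this
    omega
  · rintro (h | h | h | h)
    · have := congrArg PNat.val h
      change m = 1 at this
      omega
    · change (n : ℤ) = -1 at h; omega
    · change (n : ℤ) = 0 at h; omega
    · change (n : ℤ) = 1 at h; omega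

end KripkeFrame

/-! ### Counting and permuting by fibres. -/

theorem Set.encard_le_of_fibres {α C : Type*} {S : Set α} (col : α → C) (P : Finset C) (q : ℕ)
    (hS : ∀ x ∈ S, col x ∈ P) (hq : ∀ c ∈ P, {x ∈ S | col x = c}.encard ≤ q) :
    S.encard ≤ (P.card * q : ℕ) := by
  classical
  have hsub : S = ⋃ c ∈ P, {x ∈ S | col x = c} := by
    ext x
    simp only [Set.mem_iUnion, Set.mem_ofPred_eq, exists_prop]
    exact ⟨fun hx => ⟨col x, hS x hx, hx, rfl⟩, fun ⟨_, _, hx, _⟩ => hx⟩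
  have key : ∀ P' : Finset C, P' ⊆ P →
      (⋃ c ∈ P', {x ∈ S | col x = c}).encard ≤ (P'.card * q : ℕ) := by
    intro P'
    induction P' using Finset.induction_on with
    | empty => simp
    | insert c P' hc ih =>
      intro h
      rw [Finset.set_biUnion_insert, Finset.card_insert_of_notMem hc, add_mul, add_comm, one_mul,
        Nat.cast_add]
      refine (Set.encard_union_le _ _).trans (add_le_add (hq c (h (by simp))) ?_)
      exact ih fun x hx => h (by simp [hx])
  rw [hsub]
  exact key P subset_rfl

/-- Finiteness matters because `encard` does not separate infinite cardinals. Fibres that `p` leaves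
in place receive the identity. -/
theorem exists_perm_of_encard_fibres {W T : Type*} (τ : W → T) (p : Equiv.Perm T)
    (hfin : ∀ t, (τ ⁻¹' {t}).Finite)
    (h : ∀ t, (τ ⁻¹' {t}).encard = (τ ⁻¹' {p t}).encard) :
    ∃ σ : Equiv.Perm W, (∀ x, τ (σ x) = p (τ x)) ∧ ∀ x, p (τ x) = τ x → σ x = x := by
  have hex : ∀ t, ∃ f : W → W, Set.BijOn f (τ ⁻¹' {t}) (τ ⁻¹' {p t}) ∧
      (p t = t → ∀ x, f x = x) := by
    intro t
    by_cases ht : p t = t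
    · exact ⟨id, by rw [ht]; exact Set.bijOn_id _, fun _ _ => rfl⟩
    · rcases isEmpty_or_nonempty W with hW | hW
      · exact ⟨id, ⟨isEmptyElim, isEmptyElim, isEmptyElim⟩, fun h => absurd h ht⟩
      · obtain ⟨f, hf⟩ := (hfin t).exists_bijOn_of_encard_eq (h t)
        exact ⟨f, hf, fun h => absurd h ht⟩
  choose f hf hfix using hex
  refine ⟨Equiv.ofBijective _ (bijective_of_bijOn_fibres τ p f hf), fun x => ?_, fun x hx => ?_⟩
  · exact (hf (τ x)).mapsTo rfl
  · exact hfix (τ x) hx x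

/-! ### Thinning the roots, and exchanging two worlds of a cluster. -/

namespace KripkeFrame

variable {F : KripkeFrame.{u}}

/-- The worlds seen by `s`. -/
def succ (F : KripkeFrame.{u}) (s : F.W) : Set F.W := {x | F.R s x}

/-- The irreflexive worlds seeing exactly the worlds of `A`. -/
def roots (F : KripkeFrame.{u}) (A : Set F.W) : Set F.W := {s | ¬ F.R s s ∧ F.succ s = A}

/-- Under this bound the number of roots over a set takes at most `q + 1` values, all finite, so it
can serve as a colour and equal counts yield bijections. -/
def FewRoots (F : KripkeFrame.{u}) (q : ℕ) : Prop := ∀ A, (F.roots A).encard ≤ q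

theorem IsEuclidean.refl_of_rel (hF : F.IsEuclidean) {s t : F.W} (h : F.R s t) : F.R t t :=
  (hF _ _ _ h h).1

theorem IsEuclidean.succ_eq (hF : F.IsEuclidean) {c x : F.W} (hc : F.R c c) (hx : F.R c x) :
    F.succ x = F.succ c := by
  have hxc : F.R x c := (hF _ _ _ hc hx).2
  ext y
  exact ⟨fun hy => (hF _ _ _ hxc hy).1, fun hy => (hF _ _ _ hx hy).1⟩

theorem IsEuclidean.succ_subset (hF : F.IsEuclidean) {s c : F.W} (h : F.R s c) :
    F.succ s ⊆ F.succ c := fun _ hy => (hF _ _ _ h hy).1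

/-- By `rel_congr`, worlds of `S` with the same successors inside `S` have the same successors in
the whole frame, so no new coincidences arise. -/
theorem Absorbs.fewRoots_induce {q : ℕ} {S : Set F.W} (h : F.Absorbs q S) (hq : 2 < q)
    (hS : S.Nonempty) (hA : ∀ A, (S ∩ F.roots A).encard ≤ q) : (F.induce S hS).FewRoots q := by
  intro A
  rcases Set.eq_empty_or_nonempty ((F.induce S hS).roots A) with h0 | ⟨s, hs, rfl⟩
  · rw [h0]; simp
  · rw [← Function.Injective.encard_image (f := fun x : (F.induce S hS).W => x.1)
      Subtype.val_injective]
    refine (Set.encard_le_encard ?_).trans (hA (F.succ s.1))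
    rintro _ ⟨t, ⟨ht, hts⟩, rfl⟩
    refine ⟨t.2, ht, ?_⟩
    ext w
    exact h.rel_congr hq t.2 s.2 (fun w hw => Set.ext_iff.1 hts ⟨w, hw⟩) w

theorem IsEuclidean.exists_absorbs_roots (hF : F.IsEuclidean) (q : ℕ) :
    ∃ S, F.Absorbs q S ∧ ∀ A, (S ∩ F.roots A).encard ≤ q := by
  classical
  -- Each reflexive world has a private colour. Irreflexive worlds are seen by nobody, so
  -- transposing two with the same successors is an automorphism.
  let col : F.W → F.W ⊕ Set F.W := fun s => if F.R s s then Sum.inl s else Sum.inr (F.succ s)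
  obtain ⟨S, hS, hq⟩ := exists_colour_selection col q
  refine ⟨S, Absorbs.of_blocks id S fun i hi => ?_, fun A => ?_⟩
  · obtain ⟨T, hTS, hTq, hT⟩ := hS i hi
    refine ⟨T, hTS, hTq, fun j hj => ⟨Equiv.swap i j, ?_, fun x => Equiv.swap_apply_of_ne_of_ne,
      fun x hx => ?_⟩⟩
    · have hij : i ≠ j := by rintro rfl; exact hi (hTS hj)
      have hcol := hT j hj
      have hir : ¬ F.R i i := by
        intro h
        by_cases hj' : F.R j j <;> simp [col, h, hj', hij] at hcol
      have hjr : ¬ F.R j j := by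
        intro h
        simp [col, h, hir] at hcol
      have hsucc : ∀ y, F.R i y ↔ F.R j y := by
        simp only [col, hir, hjr, if_false, Sum.inr.injEq] at hcol
        exact fun y => Set.ext_iff.1 hcol y
      have hi' : ∀ x, ¬ F.R x i := fun x hx => hir (hF.refl_of_rel hx)
      have hj' : ∀ x, ¬ F.R x j := fun x hx => hjr (hF.refl_of_rel hx)
      intro x y
      simp only [Equiv.swap_apply_def]
      split_ifs <;> simp_all
    · change x = i at hx
      rw [hx]
      exact Equiv.swap_apply_left i j
  · refine le_trans (Set.encard_le_encard ?_) (hq (Sum.inr A))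
    rintro s ⟨hs, hsr, rfl⟩
    exact ⟨hs, by simp [col, hsr]⟩

/-- Exchanging two worlds of a cluster extends to the irreflexive worlds. -/
theorem IsEuclidean.exists_isAut_swap [DecidableEq F.W] (hF : F.IsEuclidean) {q : ℕ}
    (hfew : F.FewRoots q) {i j : F.W} (hi : F.R i i) (hij : F.R i j)
    (hn : ∀ A, (F.roots A).encard = (F.roots (Equiv.swap i j '' A)).encard) :
    ∃ σ : Equiv.Perm F.W, F.IsAut σ ∧ (∀ x, F.R x x → σ x = Equiv.swap i j x) ∧
      ∀ x, ¬ F.R x x → σ x ∈ F.roots (Equiv.swap i j '' F.succ x) ∧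
        (Equiv.swap i j '' F.succ x = F.succ x → σ x = x) := by
  classical
  have hj : F.R j j := hF.refl_of_rel hij
  have hji : F.R j i := (hF _ _ _ hi hij).2
  have hsucc : F.succ j = F.succ i := hF.succ_eq hi hij
  have hsucc' : ∀ y, F.R j y ↔ F.R i y := Set.ext_iff.1 hsucc
  have hsymm : ∀ x, F.R x x → (F.R x i ↔ F.R x j) := fun x hx =>
    ⟨fun h => by have := hF.succ_eq hx h; exact (Set.ext_iff.1 this j).1 hij,
      fun h => by have := hF.succ_eq hx h; exact (Set.ext_iff.1 this i).1 hji⟩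
  have hrefl : ∀ x, F.R (Equiv.swap i j x) (Equiv.swap i j x) ↔ F.R x x := by
    intro x
    rw [Equiv.swap_apply_def]
    split_ifs <;> simp_all
  have hpres : ∀ x y, F.R x x →
      (F.R (Equiv.swap i j x) (Equiv.swap i j y) ↔ F.R x y) := by
    intro x y hx
    have := hsymm x hx
    simp only [Equiv.swap_apply_def]
    split_ifs <;> simp_all
  -- The swap acts on these labels, and `hn` says that it respects the sizes of the fibres; a
  -- permutation of the worlds lying over this action is the desired automorphism.
  let τ : F.W → F.W ⊕ Set F.W := fun s => if F.R s s then Sum.inl s else Sum.inr (F.succ s)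
  have hτ₁ : ∀ x, F.R x x → τ x = Sum.inl x := fun x hx => if_pos hx
  have hτ₂ : ∀ x, ¬ F.R x x → τ x = Sum.inr (F.succ x) := fun x hx => if_neg hx
  have hτ₁' : ∀ x c, τ x = Sum.inl c → x = c ∧ F.R x x := by
    intro x c h
    by_cases hx : F.R x x
    · rw [hτ₁ x hx] at h; exact ⟨Sum.inl.inj h, hx⟩
    · rw [hτ₂ x hx] at h; cases h
  have hτ₂' : ∀ x A, τ x = Sum.inr A → x ∈ F.roots A := by
    intro x A h
    by_cases hx : F.R x x
    · rw [hτ₁ x hx] at h; cases h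
    · rw [hτ₂ x hx] at h; exact ⟨hx, Sum.inr.inj h⟩
  have hfib₂ : ∀ A, τ ⁻¹' {Sum.inr A} = F.roots A := by
    intro A
    ext x
    refine ⟨hτ₂' x A, fun hx => ?_⟩
    change τ x = _
    rw [hτ₂ x hx.1, hx.2]
  have hfib₁ : ∀ c, F.R c c → τ ⁻¹' {Sum.inl c} = {c} := by
    intro c hc
    ext x
    refine ⟨fun hx => (hτ₁' x c hx).1, fun hx => ?_⟩
    obtain rfl : x = c := hx
    exact hτ₁ x hc
  have hfib₁' : ∀ c, ¬ F.R c c → τ ⁻¹' {Sum.inl c} = ∅ := by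
    intro c hc
    refine Set.eq_empty_of_forall_notMem fun x hx => ?_
    obtain ⟨rfl, h⟩ := hτ₁' x c hx
    exact hc h
  obtain ⟨σ, hσ, hfix⟩ := exists_perm_of_encard_fibres τ
    (Equiv.sumCongr (Equiv.swap i j) (Equiv.Set.congr (Equiv.swap i j))) (by
      rintro (c | A)
      · by_cases hc : F.R c c
        · rw [hfib₁ c hc]; exact Set.finite_singleton c
        · rw [hfib₁' c hc]; exact Set.finite_empty
      · rw [hfib₂]; exact Set.finite_of_encard_le_coe (hfew A)) (by
      rintro (c | A)
      · simp only [Equiv.sumCongr_apply, Sum.map_inl]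
        by_cases hc : F.R c c
        · rw [hfib₁ c hc, hfib₁ _ ((hrefl c).2 hc), Set.encard_singleton, Set.encard_singleton]
        · rw [hfib₁' c hc, hfib₁' _ (mt (hrefl c).1 hc)]
      · simp only [Equiv.sumCongr_apply, Sum.map_inr, Equiv.Set.congr_apply]
        rw [hfib₂, hfib₂]
        exact hn A)
  have hσ₁ : ∀ x, F.R x x → σ x = Equiv.swap i j x := by
    intro x hx
    have := hσ x
    rw [hτ₁ x hx] at this
    exact (hτ₁' _ _ this).1
  have hσ₂ : ∀ x, ¬ F.R x x → σ x ∈ F.roots (Equiv.swap i j '' F.succ x) := by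
    intro x hx
    have := hσ x
    rw [hτ₂ x hx] at this
    exact hτ₂' _ _ this
  refine ⟨σ, fun x y => ?_, hσ₁, fun x hx => ⟨hσ₂ x hx, fun h => hfix x ?_⟩⟩
  · by_cases hy : F.R y y
    · rw [hσ₁ y hy]
      by_cases hx : F.R x x
      · rw [hσ₁ x hx, hpres x y hx]
      · have := Set.ext_iff.1 (hσ₂ x hx).2 (Equiv.swap i j y)
        rw [(Equiv.swap i j).injective.mem_set_image] at this
        exact this
    · refine iff_of_false (fun h => ?_) fun h => hy (hF.refl_of_rel h)
      exact (hσ₂ y hy).1 (hF.refl_of_rel h)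
  · rw [hτ₂ x hx]
    exact congrArg Sum.inr h

end KripkeFrame

/-! ### Shrinking the large clusters. -/

namespace KripkeFrame

variable {F : KripkeFrame.{u}}

/-- `s` is an irreflexive world below a large cluster which sees only the world `c` of the
cluster, or all its worlds but `c`. -/
def Attached (F : KripkeFrame.{u}) (k : ℕ) (s c : F.W) : Prop :=
  ¬ F.R s s ∧ F.R c c ∧ k < (F.succ c).encard ∧
    (F.succ s = {c} ∨ F.succ s = F.succ c \ {c})

/-- A cluster with more than four worlds has no singleton that is also the complement of a
singleton. Uniqueness makes each attached root belong to the block of a single world. -/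
theorem IsEuclidean.attached_unique (hF : F.IsEuclidean) {k : ℕ} (hk : 4 ≤ k) {s c d : F.W}
    (hc : F.Attached k s c) (hd : F.Attached k s d) : c = d := by
  have two : ∀ {c d : F.W}, F.R d d → k < (F.succ d).encard → {c} = F.succ d \ {d} → False := by
    intro c d hdd hd h
    have : F.succ d ⊆ {d, c} := by
      intro x hx
      by_cases hxd : x = d
      · exact Or.inl hxd
      · exact Or.inr (h.superset ⟨hx, hxd⟩)
    have h2 := hd.trans_le ((Set.encard_le_encard this).trans ((Set.encard_insert_le _ _).trans_eq
      (by rw [Set.encard_singleton, one_add_one_eq_two])))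
    have : k < 2 := by exact_mod_cast h2
    omega
  obtain ⟨-, hcc, hkc, hsc⟩ := hc
  obtain ⟨-, hdd, hkd, hsd⟩ := hd
  rcases hsc with hsc | hsc <;> rcases hsd with hsd | hsd <;> rw [hsc] at hsd
  · exact Set.singleton_injective hsd
  · exact (two hdd hkd hsd).elim
  · exact (two hcc hkc hsd.symm).elim
  · by_contra hne
    have hnon : (F.succ c \ {c}).Nonempty := by
      by_contra h
      rw [Set.not_nonempty_iff_eq_empty, Set.sdiff_eq_empty] at h
      have h1 := hkc.trans_le ((Set.encard_le_encard h).trans_eq (Set.encard_singleton c))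
      have : k < 1 := by exact_mod_cast h1
      omega
    obtain ⟨x, hx⟩ := hnon
    have h₁ := hF.succ_eq hcc hx.1
    have h₂ := hF.succ_eq hdd (hsd.subset hx).1
    have : c ∈ F.succ d \ {d} := ⟨by rw [← h₂, h₁]; exact hcc, hne⟩
    rw [← hsd] at this
    exact this.2 rfl

/-- An irreflexive world below a large cluster either is attached to one of two given worlds
of the cluster, or sees both, or neither. -/
theorem IsEuclidean.attached_or_rel_iff (hF : F.IsEuclidean) {k : ℕ}
    (hL : F.HasSimpleLargeFlowers k) {i j s : F.W} (hi : F.R i i) (hij : F.R i j)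
    (hbig : k < (F.succ i).encard) (hs : ¬ F.R s s) :
    F.Attached k s i ∨ F.Attached k s j ∨ (F.R s i ↔ F.R s j) := by
  have hj := hF.refl_of_rel hij
  have hsucc := hF.succ_eq hi hij
  by_contra! hcon
  obtain ⟨hni, hnj, hne⟩ := hcon
  have main : ∀ {i j : F.W}, F.R i i → F.R i j → k < (F.succ i).encard →
      ¬ F.Attached k s i → ¬ F.Attached k s j → F.R s i → ¬ F.R s j → False := by
    intro i j hi hij hbig hni hnj hsi hsj
    have hj := hF.refl_of_rel hij
    have hsucc := hF.succ_eq hi hij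
    -- Seeing only `i` would attach `s` to `i`, and missing only `j` would attach it to `j`; so `s`
    -- sees two worlds and misses two, against the size of the cluster.
    refine absurd (hL s i hsi ?_ ?_) (not_le.2 hbig)
    · rw [← one_add_one_eq_two, ENat.add_one_le_iff (by simp), Set.one_lt_encard_iff]
      by_contra! h
      exact hni ⟨hs, hi, hbig, Or.inl (Set.ext fun x => ⟨fun hx => h x i hx hsi, by
        rintro rfl; exact hsi⟩)⟩
    · rw [← one_add_one_eq_two, ENat.add_one_le_iff (by simp), Set.one_lt_encard_iff]
      by_contra! h
      refine hnj ⟨hs, hj, hsucc ▸ hbig, Or.inr (Set.ext fun x => ⟨fun hx => ⟨?_, ?_⟩, ?_⟩)⟩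
      · rw [hsucc]; exact hF.succ_subset hsi hx
      · rintro rfl; exact hsj hx
      · rintro ⟨hx, hxj⟩
        rw [hsucc] at hx
        by_contra hsx
        exact hxj (h x j ⟨hx, hsx⟩ ⟨hij, hsj⟩)
  rcases hne with ⟨h₁, h₂⟩ | ⟨h₁, h₂⟩
  · exact main hi hij hbig hni hnj h₁ h₂
  · exact main hj (hF _ _ _ hi hij).2 (hsucc ▸ hbig) hnj hni h₂ h₁

theorem swap_image_succ_of_rel_iff [DecidableEq F.W] {i j s : F.W}
    (h : F.R s i ↔ F.R s j) : Equiv.swap i j '' F.succ s = F.succ s := by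
  rw [Equiv.image_eq_preimage_symm, Equiv.symm_swap]
  ext x
  change F.R s (Equiv.swap i j x) ↔ F.R s x
  rw [Equiv.swap_apply_def]
  split_ifs with h₁ h₂
  · rw [h₁, h]
  · rw [h₂, h]
  · rfl

theorem swap_image_singleton_left [DecidableEq F.W] (i j : F.W) :
    Equiv.swap i j '' {i} = {j} := by simp

theorem IsEuclidean.swap_image_diff [DecidableEq F.W] (hF : F.IsEuclidean) {i j : F.W}
    (hi : F.R i i) (hij : F.R i j) :
    Equiv.swap i j '' (F.succ i \ {i}) = F.succ j \ {j} := by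
  have hsucc := hF.succ_eq hi hij
  rw [Set.image_sdiff (Equiv.swap i j).injective,
    swap_image_succ_of_rel_iff (iff_of_true hi hij), swap_image_singleton_left, hsucc]

/-- If a root has successor set `A`, then either the swap leaves `A` unchanged or `A` is one of the
four sets compared in `h₁` and `h₂`. -/
theorem IsEuclidean.encard_roots_swap [DecidableEq F.W] (hF : F.IsEuclidean) {k : ℕ}
    (hL : F.HasSimpleLargeFlowers k) {i j : F.W} (hi : F.R i i) (hij : F.R i j)
    (hbig : k < (F.succ i).encard)
    (h₁ : (F.roots {i}).encard = (F.roots {j}).encard)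
    (h₂ : (F.roots (F.succ i \ {i})).encard = (F.roots (F.succ j \ {j})).encard)
    (A : Set F.W) : (F.roots A).encard = (F.roots (Equiv.swap i j '' A)).encard := by
  have hj := hF.refl_of_rel hij
  have hji := (hF _ _ _ hi hij).2
  have key : ∀ A : Set F.W, (F.roots A).Nonempty →
      (F.roots A).encard = (F.roots (Equiv.swap i j '' A)).encard := by
    rintro A ⟨s, hs, rfl⟩
    rcases hF.attached_or_rel_iff hL hi hij hbig hs with h | h | h
    · rcases h.2.2.2 with h | h
      · rw [h, swap_image_singleton_left, h₁]
      · rw [h, hF.swap_image_diff hi hij, h₂]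
    · rcases h.2.2.2 with h | h
      · rw [h, Equiv.swap_comm, swap_image_singleton_left, h₁]
      · rw [h, Equiv.swap_comm, hF.swap_image_diff hj hji, h₂]
    · rw [swap_image_succ_of_rel_iff h]
  rcases Set.eq_empty_or_nonempty (F.roots A) with hA | hA
  · rcases Set.eq_empty_or_nonempty (F.roots (Equiv.swap i j '' A)) with hB | hB
    · rw [hA, hB]
    -- With no root over `A`, the argument runs from the swapped set, the swap being an involution.
    · have := key _ hB
      rw [Set.image_image] at this
      simp only [Equiv.swap_apply_self, Set.image_id'] at this
      exact this.symm
  · exact key A hA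

/-- A block is a world of a large cluster with the roots attached to it. Its colour is the cluster
and the numbers of roots seeing only that world and all but that world: at most `(q + 1) ^ 2`
colours per cluster, with `q` worlds kept of each. Blocks of equal colour can be exchanged. Every
other world has a private colour. -/
theorem IsEuclidean.exists_absorbs_clusters (hF : F.IsEuclidean) {k : ℕ} (hk : 4 ≤ k)
    (hL : F.HasSimpleLargeFlowers k) {q : ℕ} (hfew : F.FewRoots q) :
    ∃ S, F.Absorbs q S ∧
      ∀ c, F.R c c → (S ∩ F.succ c).encard ≤ (max k (q * (q + 1) ^ 2) : ℕ) := by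
  classical
  let b : F.W → F.W := fun x => if h : ∃ c, F.Attached k x c then h.choose else x
  have hb₁ : ∀ {x c}, F.Attached k x c → b x = c := by
    intro x c h
    have hex : ∃ c, F.Attached k x c := ⟨c, h⟩
    have : b x = hex.choose := dif_pos hex
    rw [this]
    exact hF.attached_unique hk hex.choose_spec h
  have hb₂ : ∀ {x}, (∀ c, ¬ F.Attached k x c) → b x = x := fun h => dif_neg (not_exists.2 h)
  have hb₃ : ∀ {x}, F.R x x → b x = x := fun hx => hb₂ fun c hc => hc.1 hx
  let col : F.W → (Set F.W × ℕ∞ × ℕ∞) ⊕ F.W := fun i =>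
    if F.R i i ∧ k < (F.succ i).encard then
      Sum.inl (F.succ i, (F.roots {i}).encard, (F.roots (F.succ i \ {i})).encard)
    else Sum.inr i
  obtain ⟨S, hS, hq⟩ := exists_colour_selection col q
  refine ⟨b ⁻¹' S, Absorbs.of_blocks b S fun i hi => ?_, fun c hc => ?_⟩
  · obtain ⟨T, hTS, hTq, hT⟩ := hS i hi
    refine ⟨T, hTS, hTq, fun j hj => ?_⟩
    have hne : i ≠ j := by rintro rfl; exact hi (hTS hj)
    have hcol := hT j hj
    by_cases hi' : F.R i i ∧ k < (F.succ i).encard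
    swap
    · exfalso
      by_cases hj' : F.R j j ∧ k < (F.succ j).encard
      · simp only [col, if_neg hi', if_pos hj', reduceCtorEq] at hcol
      · simp only [col, if_neg hi', if_neg hj', Sum.inr.injEq] at hcol
        exact hne hcol
    by_cases hj' : F.R j j ∧ k < (F.succ j).encard
    swap
    · exfalso
      simp only [col, if_pos hi', if_neg hj', reduceCtorEq] at hcol
    simp only [col, if_pos hi', if_pos hj', Sum.inl.injEq, Prod.mk.injEq] at hcol
    obtain ⟨hsucc, h₁, h₂⟩ := hcol
    obtain ⟨hii, hbig⟩ := hi'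
    obtain ⟨hjj, hbigj⟩ := hj'
    have hij : F.R i j := hsucc.superset hjj
    obtain ⟨σ, hσ, hσ₁, hσ₂⟩ := hF.exists_isAut_swap hfew hii hij
      (hF.encard_roots_swap hL hii hij hbig h₁ h₂)
    refine ⟨σ, hσ, fun x hxi hxj => ?_, fun x hx => ?_⟩
    · by_cases hxx : F.R x x
      · rw [hb₃ hxx] at hxi hxj
        rw [hσ₁ x hxx, Equiv.swap_apply_of_ne_of_ne hxi hxj]
      · refine (hσ₂ x hxx).2 (swap_image_succ_of_rel_iff ?_)
        rcases hF.attached_or_rel_iff hL hii hij hbig hxx with h | h | h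
        · exact absurd (hb₁ h) hxi
        · exact absurd (hb₁ h) hxj
        · exact h
    · by_cases hxx : F.R x x
      · rw [hb₃ hxx] at hx
        rw [hσ₁ x hxx, hx, Equiv.swap_apply_left, hb₃ hjj]
      · have hatt : F.Attached k x i := by
          by_contra hno
          by_cases hex : ∃ c, F.Attached k x c
          · obtain ⟨c, hc⟩ := hex
            have := hb₁ hc
            exact hno (by rw [← hx, this]; exact hc)
          · rw [hb₂ (not_exists.1 hex)] at hx
            exact hxx (hx ▸ hii)
        obtain ⟨hroot, hsx⟩ := (hσ₂ x hxx).1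
        refine hb₁ ⟨hroot, hjj, hbigj, ?_⟩
        rcases hatt.2.2.2 with h | h
        · left; rw [hsx, h, swap_image_singleton_left]
        · right; rw [hsx, h, hF.swap_image_diff hii hij]
  · by_cases hbig : k < (F.succ c).encard
    · let P : Finset (ℕ∞ × ℕ∞) :=
        (Finset.range (q + 1) ×ˢ Finset.range (q + 1)).image fun p => (p.1, p.2)
      have hP : P.card ≤ (q + 1) ^ 2 := by
        refine Finset.card_image_le.trans ?_
        rw [Finset.card_product, Finset.card_range, sq]
      have hlt : ∀ A, ∃ n : ℕ, n < q + 1 ∧ (n : ℕ∞) = (F.roots A).encard := by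
        intro A
        have := hfew A
        obtain ⟨n, hn⟩ := ENat.ne_top_iff_exists.1
          (ne_top_of_le_ne_top (ENat.natCast_ne_top q) this)
        rw [← hn] at this
        exact ⟨n, Nat.lt_succ_of_le (by exact_mod_cast this), hn⟩
      refine (Set.encard_le_of_fibres
        (fun x => ((F.roots {x}).encard, (F.roots (F.succ x \ {x})).encard)) P q ?_ ?_).trans ?_
      · rintro x -
        obtain ⟨m, hm, hm'⟩ := hlt {x}
        obtain ⟨n, hn, hn'⟩ := hlt (F.succ x \ {x})
        exact Finset.mem_image.2 ⟨(m, n),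
          Finset.mem_product.2 ⟨Finset.mem_range.2 hm, Finset.mem_range.2 hn⟩, by rw [← hm', ← hn']⟩
      · rintro p -
        refine (Set.encard_le_encard ?_).trans (hq (Sum.inl (F.succ c, p)))
        rintro x ⟨⟨hxS, hxc⟩, rfl⟩
        have hxx := hF.refl_of_rel hxc
        have hsx := hF.succ_eq hc hxc
        change b x ∈ S at hxS
        rw [hb₃ hxx] at hxS
        refine ⟨hxS, ?_⟩
        have : F.R x x ∧ k < (F.succ x).encard := ⟨hxx, hsx ▸ hbig⟩
        simp only [col, if_pos this, hsx]
      · norm_cast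
        calc P.card * q ≤ (q + 1) ^ 2 * q := by gcongr
          _ = q * (q + 1) ^ 2 := mul_comm _ _
          _ ≤ _ := le_max_right _ _
    · rw [not_lt] at hbig
      refine (Set.encard_le_encard Set.inter_subset_right).trans (hbig.trans ?_)
      exact_mod_cast le_max_left _ _

end KripkeFrame

/-! ### Components and their isomorphism types. -/

namespace KripkeFrame

variable {F : KripkeFrame.{u}}

/-- The cluster above, or around, a world; empty if the world sees nothing. -/
def cluster (F : KripkeFrame.{u}) (x : F.W) : Set F.W := {t | ∃ w, F.R x w ∧ F.R w t}

theorem IsEuclidean.cluster_eq_succ (hF : F.IsEuclidean) {x y : F.W} (h : F.R x y) :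
    F.cluster x = F.succ y := by
  ext t
  refine ⟨fun ⟨w, hw, hwt⟩ => ?_, fun ht => ⟨y, h, ht⟩⟩
  rw [← hF.succ_eq (hF.refl_of_rel h) (hF _ _ _ h hw).1]
  exact hwt

/-- Hence no relation joins distinct fibres of `cluster`, which serve as components. The fibre over
`∅` gathers all worlds that see nothing. -/
theorem IsEuclidean.cluster_eq (hF : F.IsEuclidean) {x y : F.W} (h : F.R x y) :
    F.cluster x = F.cluster y := by
  rw [hF.cluster_eq_succ h, hF.cluster_eq_succ (hF.refl_of_rel h)]

/-- The isomorphism types of relations on at most `n` elements. -/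
abbrev RelCode (n : ℕ) : Type := Fin (n + 1) × Set (Fin n × Fin n)

/-- The code is the size of `X` with the relation transported along an enumeration. It depends on
the enumeration, but only one direction is used: equal codes give isomorphic relations. -/
theorem exists_relCode {W : Type*} (R : W → W → Prop) {n : ℕ} {X : Set W} (hX : X.encard ≤ n) :
    ∃ (c : RelCode n) (e : W → ℕ), Set.BijOn e X (Set.Iio c.1) ∧
      ∀ x ∈ X, ∀ y ∈ X, R x y ↔ ∃ p ∈ c.2, (p.1 : ℕ) = e x ∧ (p.2 : ℕ) = e y := by
  rcases isEmpty_or_nonempty W with hW | hW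
  · refine ⟨(0, ∅), isEmptyElim, ⟨isEmptyElim, isEmptyElim, ?_⟩, isEmptyElim⟩
    rintro m hm
    exact absurd hm (Nat.not_lt_zero m)
  have hfin := Set.finite_of_encard_le_coe hX
  have hm : X.ncard ≤ n := by
    rw [← hfin.cast_ncard_eq] at hX
    exact_mod_cast hX
  obtain ⟨e, he⟩ := hfin.exists_bijOn_of_encard_eq (t := Set.Iio X.ncard) (by
    rw [← hfin.cast_ncard_eq, ← Finset.coe_Iio, Set.encard_coe_eq_coe_finsetCard, Nat.card_Iio])
  refine ⟨(⟨X.ncard, Nat.lt_succ_of_le hm⟩,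
    {p | ∃ x ∈ X, ∃ y ∈ X, (p.1 : ℕ) = e x ∧ (p.2 : ℕ) = e y ∧ R x y}), e, he, ?_⟩
  intro x hx y hy
  constructor
  · intro h
    exact ⟨(⟨e x, (he.mapsTo hx).trans_le hm⟩, ⟨e y, (he.mapsTo hy).trans_le hm⟩),
      ⟨x, hx, y, hy, rfl, rfl, h⟩, rfl, rfl⟩
  · rintro ⟨p, ⟨x', hx', y', hy', h₁, h₂, h⟩, h₁', h₂'⟩
    obtain rfl := he.injOn hx' hx (h₁.symm.trans h₁')
    obtain rfl := he.injOn hy' hy (h₂.symm.trans h₂')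
    exact h

/-- If all components of a frame have at most `n` worlds, it is enough to keep `q` components of
each isomorphism type. -/
theorem IsEuclidean.exists_absorbs_components (hF : F.IsEuclidean) (q n : ℕ)
    (hn : ∀ C, (F.cluster ⁻¹' {C}).encard ≤ n) :
    ∃ S, F.Absorbs q S ∧ S.encard ≤ ((n + 1) * 2 ^ n ^ 2 * q * n : ℕ) := by
  classical
  choose code e he hcode using fun C => exists_relCode F.R (hn C)
  have hiso : ∀ C D, code C = code D → ∃ f : F.W → F.W,
      Set.BijOn f (F.cluster ⁻¹' {C}) (F.cluster ⁻¹' {D}) ∧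
      ∀ x ∈ F.cluster ⁻¹' {C}, ∀ y ∈ F.cluster ⁻¹' {C}, F.R (f x) (f y) ↔ F.R x y := by
    intro C D hCD
    have := F.nonempty
    have heD : Set.BijOn (e D) (F.cluster ⁻¹' {D}) (Set.Iio (code C).1) := hCD ▸ he D
    have hinv := heD.invOn_invFunOn
    have hbij := (Set.bijOn_comm hinv).2 heD
    -- The isomorphism numbers a world of the first component and takes the world with the same
    -- number in the second.
    refine ⟨_, hbij.comp (he C), fun x hx y hy => ?_⟩
    have hfx := (hbij.comp (he C)).mapsTo hx
    have hfy := (hbij.comp (he C)).mapsTo hy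
    rw [hcode C x hx y hy, hcode D _ hfx _ hfy, ← hCD]
    simp only [Function.comp_apply]
    rw [hinv.2 ((he C).mapsTo hx), hinv.2 ((he C).mapsTo hy)]
  obtain ⟨S, hS, hq⟩ := exists_colour_selection code q
  refine ⟨F.cluster ⁻¹' S, Absorbs.of_blocks _ S fun i hi => ?_, ?_⟩
  · obtain ⟨T, hTS, hTq, hT⟩ := hS i hi
    refine ⟨T, hTS, hTq, fun j hj => ?_⟩
    have hcol := hT j hj
    have hex : ∀ t, ∃ f : F.W → F.W,
        (Set.BijOn f (F.cluster ⁻¹' {t}) (F.cluster ⁻¹' {Equiv.swap i j t}) ∧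
        ∀ x ∈ F.cluster ⁻¹' {t}, ∀ y ∈ F.cluster ⁻¹' {t}, F.R (f x) (f y) ↔ F.R x y) ∧
        (t ≠ i → t ≠ j → ∀ x, f x = x) := by
      intro t
      by_cases hti : t = i
      · subst hti
        obtain ⟨f, hf⟩ := hiso t j hcol
        exact ⟨f, by rwa [Equiv.swap_apply_left], fun h => absurd rfl h⟩
      by_cases htj : t = j
      · subst htj
        obtain ⟨f, hf⟩ := hiso t i hcol.symm
        exact ⟨f, by rwa [Equiv.swap_apply_right], fun _ h => absurd rfl h⟩
      · refine ⟨id, ⟨?_, fun _ _ _ _ => Iff.rfl⟩, fun _ _ _ => rfl⟩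
        rw [Equiv.swap_apply_of_ne_of_ne hti htj]
        exact Set.bijOn_id _
    choose f hf hfix using hex
    let σ : Equiv.Perm F.W := Equiv.ofBijective _
      (bijective_of_bijOn_fibres F.cluster (Equiv.swap i j) f fun t => (hf t).1)
    have hσ : ∀ x, σ x = f (F.cluster x) x := fun _ => rfl
    have hcl : ∀ x, F.cluster (σ x) = Equiv.swap i j (F.cluster x) := fun x =>
      (hf (F.cluster x)).1.mapsTo rfl
    refine ⟨σ, fun x y => ?_, fun x hxi hxj => hfix _ hxi hxj x, fun x hx => ?_⟩
    · by_cases hxy : F.cluster x = F.cluster y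
      · rw [hσ, hσ, ← hxy]
        exact (hf _).2 x rfl y hxy.symm
      · refine iff_of_false (fun h => hxy ?_) fun h => hxy (hF.cluster_eq h)
        have := hF.cluster_eq h
        rw [hcl, hcl] at this
        exact (Equiv.swap i j).injective this
    · rw [hcl, hx, Equiv.swap_apply_left]
  · have hScard : S.encard ≤ ((n + 1) * 2 ^ n ^ 2 * q : ℕ) := by
      refine (Set.encard_le_of_fibres code Finset.univ q (fun _ _ => Finset.mem_univ _)
        fun c _ => hq c).trans ?_
      rw [Finset.card_univ, Fintype.card_prod, Fintype.card_fin, Fintype.card_set,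
        Fintype.card_prod, Fintype.card_fin, sq]
    have hSfin := Set.finite_of_encard_le_coe hScard
    refine (Set.encard_le_of_fibres F.cluster hSfin.toFinset n (fun x hx => by simpa using hx)
      fun C _ => (Set.encard_le_encard fun x hx => hx.2).trans (hn C)).trans ?_
    rw [hSfin.encard_eq_coe_toFinset_card] at hScard
    have : hSfin.toFinset.card ≤ (n + 1) * 2 ^ n ^ 2 * q := by exact_mod_cast hScard
    exact_mod_cast Nat.mul_le_mul_right n this

/-- A component is its cluster plus at most `q` roots for each possible successor set. A cluster of
at most `k` worlds has at most `2 ^ k` such sets; a larger one, of at most `N` worlds, admits only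
singletons, their complements and itself, hence `2 * N + 1`. -/
theorem IsEuclidean.encard_component_le (hF : F.IsEuclidean) {k q : ℕ} (hk : 4 ≤ k)
    (hq : 1 ≤ q) (hL : F.HasSimpleLargeFlowers k) (hfew : F.FewRoots q)
    (hcl : ∀ c, F.R c c → (F.succ c).encard ≤ (max k (q * (q + 1) ^ 2) : ℕ)) (C : Set F.W) :
    (F.cluster ⁻¹' {C}).encard ≤ (2 * q * (q * (q + 1) ^ 2 + 1) * 2 ^ k : ℕ) := by
  classical
  set N := q * (q + 1) ^ 2
  have hqN : 2 * q ≤ 2 * q * (N + 1) := Nat.le_mul_of_pos_right _ (by omega)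
  have hpos : 1 ≤ 2 ^ k := Nat.one_le_two_pow
  by_cases hC : ∃ x, F.cluster x = C ∧ ∃ c, F.R x c
  swap
  -- Here the fibre consists of worlds that see nothing, which are the roots over `∅`.
  · refine (Set.encard_le_encard (t := F.roots ∅) fun x hx => ?_).trans ((hfew ∅).trans ?_)
    · have hno : ∀ c, ¬ F.R x c := fun c hc => hC ⟨x, hx, c, hc⟩
      exact ⟨hno x, Set.eq_empty_of_forall_notMem hno⟩
    · have : q ≤ 2 * q * (N + 1) * 2 ^ k :=
        (by omega : q ≤ 2 * q * (N + 1)).trans (Nat.le_mul_of_pos_right _ hpos)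
      exact_mod_cast this
  obtain ⟨x₀, hx₀, c, hx₀c⟩ := hC
  have hcc := hF.refl_of_rel hx₀c
  have hCc : C = F.succ c := by rw [← hx₀, hF.cluster_eq_succ hx₀c]
  have hsub : ∀ x, F.cluster x = C → (F.succ x).Nonempty ∧ F.succ x ⊆ C := by
    intro x hx
    obtain ⟨w, hw, -⟩ : c ∈ F.cluster x := by rw [hx, hCc]; exact hcc
    refine ⟨⟨w, hw⟩, ?_⟩
    rw [← hx, hF.cluster_eq_succ hw]
    exact hF.succ_subset hw
  have hCle := hcl c hcc
  rw [← hCc] at hCle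
  have hCfin : C.Finite := Set.finite_of_encard_le_coe hCle
  have hsplit : F.cluster ⁻¹' {C} ⊆ C ∪ {x | ¬ F.R x x ∧ F.cluster x = C} := by
    intro x hx
    by_cases hxx : F.R x x
    · left
      have : F.cluster x = C := hx
      rw [← this, hF.cluster_eq_succ hxx]
      exact hxx
    · exact Or.inr ⟨hxx, hx⟩
  have hcount : ∀ (P : Finset (Set F.W)) (m M : ℕ), C.encard ≤ m → P.card ≤ M →
      (∀ x, F.cluster x = C → F.succ x ∈ P) →
      (F.cluster ⁻¹' {C}).encard ≤ (m + M * q : ℕ) := by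
    intro P m M hm hM hP
    refine (Set.encard_le_encard hsplit).trans ((Set.encard_union_le _ _).trans ?_)
    rw [Nat.cast_add]
    refine add_le_add hm ((Set.encard_le_of_fibres F.succ P q (fun x hx => hP x hx.2)
      fun A _ => (Set.encard_le_encard ?_).trans (hfew A)).trans ?_)
    · rintro x ⟨⟨hx, -⟩, rfl⟩
      exact ⟨hx, rfl⟩
    · exact_mod_cast Nat.mul_le_mul_right q hM
  set D := hCfin.toFinset
  have hDcard : C.encard = D.card := hCfin.encard_eq_coe_toFinset_card
  by_cases hsmall : C.encard ≤ k
  · have hDk : D.card ≤ k := by rw [hDcard] at hsmall; exact_mod_cast hsmall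
    refine (hcount (D.powerset.image fun E : Finset F.W => (E : Set F.W)) k (2 ^ k) hsmall
      ?_ ?_).trans ?_
    · refine Finset.card_image_le.trans ?_
      rw [Finset.card_powerset]
      exact Nat.pow_le_pow_right (by norm_num) hDk
    · intro x hx
      have hsx := (hsub x hx).2
      refine Finset.mem_image.2 ⟨(hCfin.subset hsx).toFinset, ?_, Set.Finite.coe_toFinset _⟩
      rw [Finset.mem_powerset]
      exact Set.Finite.toFinset_subset_toFinset.2 hsx
    · have h2 : k ≤ 2 ^ k := Nat.lt_two_pow_self.le
      have : k + 2 ^ k * q ≤ 2 * q * (N + 1) * 2 ^ k := by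
        calc k + 2 ^ k * q ≤ 2 ^ k * q + 2 ^ k * q :=
              Nat.add_le_add_right (h2.trans (Nat.le_mul_of_pos_right _ hq)) _
          _ = 2 * q * 2 ^ k := by ring
          _ ≤ _ := Nat.mul_le_mul_right _ hqN
      exact_mod_cast this
  · rw [not_le] at hsmall
    have hDk : k < D.card := by rw [hDcard] at hsmall; exact_mod_cast hsmall
    have hDN : D.card ≤ N := by
      rw [hDcard] at hCle
      have : D.card ≤ max k N := by exact_mod_cast hCle
      rcases le_max_iff.1 this with h | h
      · omega
      · exact h
    refine (hcount (D.image (fun d => {d}) ∪ D.image (fun d => C \ {d}) ∪ {C}) N (2 * N + 1)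
      ?_ ?_ ?_).trans ?_
    · rw [hDcard]; exact_mod_cast hDN
    · refine (Finset.card_union_le _ _).trans ?_
      rw [Finset.card_singleton, two_mul]
      refine Nat.add_le_add_right ((Finset.card_union_le _ _).trans ?_) 1
      exact Nat.add_le_add (Finset.card_image_le.trans hDN) (Finset.card_image_le.trans hDN)
    · intro x hx
      obtain ⟨⟨w, hw⟩, hsx⟩ := hsub x hx
      have hmemD : ∀ d, d ∈ D ↔ d ∈ C := fun d => hCfin.mem_toFinset
      have hCw : C = F.succ w := by rw [← hx, hF.cluster_eq_succ hw]
      have hlarge : ¬ {y | F.R w y}.encard ≤ k := by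
        change ¬ (F.succ w).encard ≤ k
        rw [← hCw, not_le]
        exact hsmall
      have hdich : ¬ 2 ≤ (F.succ x).encard ∨ ¬ 2 ≤ {y | F.R w y ∧ ¬ F.R x y}.encard := by
        by_contra! h
        exact hlarge (hL x w hw h.1 h.2)
      simp only [Finset.mem_union, Finset.mem_image, Finset.mem_singleton, hmemD]
      rw [← one_add_one_eq_two, ENat.add_one_le_iff (by simp), Set.one_lt_encard_iff,
        ENat.add_one_le_iff (by simp), Set.one_lt_encard_iff] at hdich
      push Not at hdich
      rcases hdich with h | h
      · exact Or.inl (Or.inl ⟨w, hsx hw, Set.ext fun y => ⟨by rintro rfl; exact hw,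
          fun hy => h y w hy hw⟩⟩)
      · by_cases hall : ∃ d, F.R w d ∧ ¬ F.R x d
        · obtain ⟨d, hd, hd'⟩ := hall
          refine Or.inl (Or.inr ⟨d, hCw.superset hd, Set.ext fun y => ⟨?_, fun hy => ⟨hsx hy, ?_⟩⟩⟩)
          · rintro ⟨hy, hyd⟩
            by_contra hxy
            exact hyd (h y d ⟨hCw.subset hy, hxy⟩ ⟨hd, hd'⟩)
          · rintro rfl
            exact hd' hy
        · push Not at hall
          refine Or.inr (hsx.antisymm ?_)
          rw [hCw]
          exact hall
    · have h2k : 2 ≤ 2 ^ k := by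
        calc 2 = 2 ^ 1 := rfl
          _ ≤ 2 ^ k := Nat.pow_le_pow_right (by norm_num) (by omega)
      have : N + (2 * N + 1) * q ≤ 2 * q * (N + 1) * 2 ^ k := by
        calc N + (2 * N + 1) * q ≤ N * q + (2 * N + 1) * q :=
              Nat.add_le_add_right (Nat.le_mul_of_pos_right _ hq) _
          _ ≤ 2 * q * (N + 1) * 2 := by nlinarith [Nat.zero_le (N * q)]
          _ ≤ _ := Nat.mul_le_mul_left _ h2k
      exact_mod_cast this

/-! ### The finite countermodel and the equivalence. -/

/-- The order of the rounds matters: few roots make the cluster colours finite in number, and small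
clusters with few roots make the components small enough to have finitely many types. -/
theorem IsEuclidean.exists_finite_countermodel (hF : F.IsEuclidean) {L : Set ModalFormula}
    {φ : ModalFormula} (hL : L = logicK5Plus φ) (hφ : F.ModalValid φ) {k : ℕ} (hk4 : 4 ≤ k)
    (hk : ∀ (m : ℕ+) (n : NMinus), (m, n) ∈ flowerSet L \ simplePairs →
      (m : ℤ) + n.1 ≤ (k : ℤ)) {A : FrameFormula} (hA : A.IsSentence) (hAF : ¬ F.FOValid A) :
    ∃ G : KripkeFrame.{u}, G.IsEuclidean ∧ Finite G.W ∧
      Nat.card G.W ≤ frameSizeBound A.qdd k ∧ G.ModalValid φ ∧ ¬ G.FOValid A := by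
  have hq3 : 3 ≤ A.qdd := le_max_right _ _
  have hqd : A.qd ≤ A.qdd := le_max_left _ _
  set q := A.qdd
  have hsimple : ∀ {G : KripkeFrame.{u}}, G.IsEuclidean → G.ModalValid φ →
      G.HasSimpleLargeFlowers k := fun hG hGφ =>
    hG.hasSimpleLargeFlowers (hL ▸ (mem_frameClass_logicK5Plus _ φ).2 ⟨hG, hGφ⟩) hk4 hk
  obtain ⟨S₁, h₁, hroots₁⟩ := hF.exists_absorbs_roots q
  have hS₁ := h₁.nonempty (by omega)
  have hF₁ := hF.induce S₁ hS₁
  have hφ₁ := h₁.modalValid (by omega) hF hS₁ hφ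
  have hA₁ := mt (h₁.foValid hS₁ hA hqd) hAF
  have hfew₁ := h₁.fewRoots_induce (by omega) hS₁ hroots₁
  generalize F.induce S₁ hS₁ = F₁ at *
  obtain ⟨S₂, h₂, hcl₂⟩ := hF₁.exists_absorbs_clusters hk4 (hsimple hF₁ hφ₁) hfew₁
  have hS₂ := h₂.nonempty (by omega)
  have hF₂ := hF₁.induce S₂ hS₂
  have hφ₂ := h₂.modalValid (by omega) hF₁ hS₂ hφ₁
  have hA₂ := mt (h₂.foValid hS₂ hA hqd) hA₁
  have hfew₂ := h₂.fewRoots_induce (by omega) hS₂ fun A =>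
    (Set.encard_le_encard Set.inter_subset_right).trans (hfew₁ A)
  have hcl : ∀ c, (F₁.induce S₂ hS₂).R c c →
      ((F₁.induce S₂ hS₂).succ c).encard ≤ (max k (q * (q + 1) ^ 2) : ℕ) := by
    intro c hc
    rw [← Function.Injective.encard_image (f := fun x : (F₁.induce S₂ hS₂).W => x.1)
      Subtype.val_injective]
    refine (Set.encard_le_encard ?_).trans (hcl₂ c.1 hc)
    rintro _ ⟨x, hx, rfl⟩
    exact ⟨x.2, hx⟩
  generalize F₁.induce S₂ hS₂ = F₂ at *
  obtain ⟨S₃, h₃, hcard⟩ := hF₂.exists_absorbs_components q _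
    (hF₂.encard_component_le hk4 (by omega) (hsimple hF₂ hφ₂) hfew₂ hcl)
  have hS₃ := h₃.nonempty (by omega)
  have hfin : S₃.Finite := Set.finite_of_encard_le_coe hcard
  refine ⟨F₂.induce S₃ hS₃, hF₂.induce S₃ hS₃, hfin.to_subtype, ?_,
    h₃.modalValid (by omega) hF₂ hS₃ hφ₂, mt (h₃.foValid hS₃ hA hqd) hA₂⟩
  rw [← hfin.cast_ncard_eq] at hcard
  have hcard' := Nat.cast_le.1 hcard
  refine le_trans (Nat.card_coe_set_eq S₃).le (hcard'.trans ?_)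
  simp only [frameSizeBound]
  generalize 2 * q * (q * (q + 1) ^ 2 + 1) = Q
  generalize 2 ^ k = K
  generalize 2 ^ (Q * K) ^ 2 = E
  -- The construction beats the stated bound by a factor `2 * (Q * K + 1)`.
  calc (Q * K + 1) * E * q * (Q * K) = 1 * q * ((Q * K + 1) * 1) * E * Q * K := by ring
    _ ≤ 2 * q * ((Q * K + 1) * (Q * K + 1)) * E * Q * K := by gcongr <;> omega
    _ = 2 * q * (Q * K + 1) ^ 2 * E * Q * K := by ring

end KripkeFrame

theorem mainTheorem7 (L : Set ModalFormula) (hL : IsEuclideanModalLogic L)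
    (hfin : (flowerSet L \ simplePairs).Finite)
    (φ : ModalFormula) (hφ : L = logicK5Plus φ)
    (k : ℕ)
    (hk : IsLeast {k : ℕ | 4 ≤ k ∧ ∀ (m : ℕ+) (n : NMinus),
      (m, n) ∈ flowerSet L \ simplePairs → (m : ℤ) + n.1 ≤ (k : ℤ)} k)
    (A : FrameFormula) (hA : A.IsSentence) :
    A ∈ theoryOf (frameClass.{u} L) ↔
      ∀ F : KripkeFrame.{u}, F.IsEuclidean → Finite F.W →
        Nat.card F.W ≤ frameSizeBound A.qdd k → F.ModalValid φ → F.FOValid A := by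
  constructor
  · rintro ⟨-, h⟩ F hF - - hFφ
    exact h F (hφ ▸ (F.mem_frameClass_logicK5Plus φ).2 ⟨hF, hFφ⟩)
  · refine fun h => ⟨hA, fun F hFL => ?_⟩
    obtain ⟨hF, hFφ⟩ := (F.mem_frameClass_logicK5Plus φ).1 (hφ ▸ hFL)
    by_contra hAF
    obtain ⟨G, hG, hfinG, hcard, hGφ, hGA⟩ :=
      hF.exists_finite_countermodel hφ hFφ hk.1.1 hk.1.2 hA hAF
    exact hGA (h G hG hfinG hcard hGφ)
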